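/- Let $\mathcal{E}$ be an elementary topos with chosen finite products, and let $(\Sigma,E)$ be an algebraic variety, i.e. a set $\Sigma$ of operation symbols of finite arity together with a set $E$ of equations between terms in finitely many variables; $(\Sigma,E)$-algebras are taken in $\mathcal{E}$. All formulas below are in the internal language of $\mathcal{E}$. An internal commutative quantale is an object $Q$ of $\mathcal{E}$ with a commutative monoid structure $(\otimes,k)$, an internal partial order $\le$ and a join operation $\bigvee : P(Q)\to Q$ over which $\otimes$ distributes. A morphism $h : Q_1\to Q_2$ of internal commutative quantales is a homomorphism of internal monoids that preserves joins. Let $\mathbf{Rel}_{(\Sigma,E)}(Q)$ be the partially ordered symmetric monoidal category with: objects: the $(\Sigma,E)$-algebras in $\mathcal{E}$; morphisms $A\to B$: the algebraic $Q$-relations, i.e. the morphisms $R : A\times B\to Q$ of $\mathcal{E}$ such that $R(a_1,b_1)\otimes\cdots\otimes R(a_n,b_n)\le R(\sigma(a_1,\dots,a_n),\sigma(b_1,\dots,b_n))$ for every $n$-ary $\sigma\in\Sigma$; identities $1_A(a_1,a_2)=\bigvee\{k\mid a_1=a_2\}$ and composition $(S\circ R)(a,c)=\bigvee_b R(a,b)\otimes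 S(b,c)$; tensor product: the product of algebras on objects and $(R\otimes R')((a,a'),(b,b'))=R(a,b)\otimes R'(a',b')$ on morphisms, with the terminal algebra as unit; the associator, unitors and symmetry are the graphs $f_\circ(a,b)=\bigvee\{k\mid f(a)=b\}$ of those of the finite products; order: $R\subseteq R'$ iff $\forall a,b.\ R(a,b)\le R'(a,b)$. Then every morphism $h : Q_1\to Q_2$ of internal commutative quantales induces an identity-on-objects, strict symmetric monoidal $\mathbf{Pos}$-functor (i.e. a functor monotone on hom-posets) $$h^* : \mathbf{Rel}_{(\Sigma,E)}(Q_1)\to \mathbf{Rel}_{(\Sigma,E)}(Q_2),\qquad h^*(R)=\bigl(A\times B\xrightarrow{R}Q_1\xrightarrow{h}Q_2\bigr).$$ The assignment $h\mapsto h^*$ is functorial: $(1_Q)^*$ is the identity functor, and $(g\circ h)^*=g^*\circ h^*$ for $h : Q_1\to Q_2$ and $g : Q_2\to Q_3$. -/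

import Mathlib

open CategoryTheory MonoidalCategory CartesianMonoidalCategory Limits MonoidalClosed
open scoped MonObj

universe w v u

noncomputable section

namespace QRel

section InternalLogic

variable {E : Type u} [Category.{v} E] [CartesianMonoidalCategory E] [HasFiniteLimits E]
  [MonoidalClosed E] [HasSubobjectClassifier E]

/-- The object of truth values of the topos `E`. -/
abbrev Om (E : Type u) [Category.{v} E] [HasSubobjectClassifier E] : E :=
  HasSubobjectClassifier.Ω E

/-- The formula "true" in context `X`. -/
def top (X : E) : X ⟶ Om E := Subobject.Classifier.χ₀ _ X ≫ HasSubobjectClassifier.truth E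

/-- A formula `φ` in context `X` holds. -/
def Holds {X : E} (φ : X ⟶ Om E) : Prop := φ = top X

/-- The internal formula `p(x) = q(x)` in context `X`. -/
def eqF {X Z : E} (p q : X ⟶ Z) : X ⟶ Om E := HasSubobjectClassifier.χ (equalizer.ι p q)

/-- The internal conjunction `φ ∧ ψ`, i.e. `(φ, ψ) = (true, true)`. -/
def andF {X : E} (φ ψ : X ⟶ Om E) : X ⟶ Om E := eqF (lift φ ψ) (lift (top X) (top X))

/-- The internal implication `φ ⇒ ψ`, i.e. `(φ ∧ ψ) = φ`. -/
def impF {X : E} (φ ψ : X ⟶ Om E) : X ⟶ Om E := eqF (andF φ ψ) φ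

/-- The internal universal quantifier `∀ b : B, φ(b, x)`, i.e. `{b | φ(b, x)} = {b | true}`. -/
def allF {B X : E} (φ : B ⊗ X ⟶ Om E) : X ⟶ Om E := eqF (curry φ) (curry (top (B ⊗ X)))

/-- The internal existential quantifier `∃ b : B, φ(b, x)`, in its usual higher-order form
`∀ ω : Ω, (∀ b : B, φ(b, x) ⇒ ω) ⇒ ω`. -/
def exF {B X : E} (φ : B ⊗ X ⟶ Om E) : X ⟶ Om E :=
  allF (B := Om E)
    (impF (allF (B := B) (X := Om E ⊗ X) (impF (B ◁ snd (Om E) X ≫ φ) (snd B _ ≫ fst (Om E) X)))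
      (fst (Om E) X))

/-- The power object of `A`. -/
abbrev PowObj (A : E) : E := (ihom A).obj (Om E)

/-- Membership of a generalized element `a` of `A` in a generalized element `S` of the power
object of `A`. -/
def Mem {X A : E} (a : X ⟶ A) (S : X ⟶ PowObj A) : Prop :=
  Holds (lift a S ≫ (ihom.ev A).app (Om E))

/-- The internal comprehension term `{a : A | φ(a, x)}` in context `X`. -/
abbrev setOfF {A X : E} (φ : A ⊗ X ⟶ Om E) : X ⟶ PowObj A := curry φ

lemma comp_top {X Y : E} (f : Y ⟶ X) : f ≫ top X = top Y := by
  unfold top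
  rw [← Category.assoc]
  congr 1
  exact Subsingleton.elim _ _

lemma Holds.comp {X Y : E} {φ : X ⟶ Om E} (h : Holds φ) (f : Y ⟶ X) : Holds (f ≫ φ) := by
  unfold Holds at *
  rw [h, comp_top]

lemma holds_eqF {X Z Y : E} (p q : X ⟶ Z) (f : Y ⟶ X) :
    Holds (f ≫ eqF p q) ↔ f ≫ p = f ≫ q := by
  have hp := HasSubobjectClassifier.isPullback_χ (equalizer.ι p q)
  constructor
  · intro h
    have h' : f ≫ HasSubobjectClassifier.χ (equalizer.ι p q) =
        Subobject.Classifier.χ₀ _ Y ≫ HasSubobjectClassifier.truth E := h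
    have := hp.lift_fst f _ h'
    rw [← this, Category.assoc, Category.assoc, equalizer.condition]
  · intro h
    have hf : equalizer.lift f h ≫ equalizer.ι p q = f := equalizer.lift_ι f h
    unfold Holds eqF
    rw [← hf, Category.assoc, hp.w]
    exact comp_top _

lemma lift_comp_eq {X A B : E} {Z : E} (f : Z ⟶ X) (a : X ⟶ A) (b : X ⟶ B) :
    f ≫ lift a b = lift (f ≫ a) (f ≫ b) := comp_lift _ _ _

lemma holds_andF {X Y : E} (φ ψ : X ⟶ Om E) (f : Y ⟶ X) :
    Holds (f ≫ andF φ ψ) ↔ Holds (f ≫ φ) ∧ Holds (f ≫ ψ) := by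
  unfold andF
  rw [holds_eqF, comp_lift, comp_lift]
  unfold Holds
  rw [comp_top]
  constructor
  · intro h
    exact ⟨by simpa using congrArg (· ≫ fst _ _) h, by simpa using congrArg (· ≫ snd _ _) h⟩
  · rintro ⟨h1, h2⟩
    rw [h1, h2]

/-- Every formula is the classifying map of a subobject. -/
lemma om_le {X : E} (φ ψ : X ⟶ Om E)
    (h : ∀ {Y : E} (f : Y ⟶ X), Holds (f ≫ φ) ↔ Holds (f ≫ ψ)) : φ = ψ := by
  have key : ∀ (χ : X ⟶ Om E),
      IsPullback (equalizer.ι χ (top X)) (Subobject.Classifier.χ₀ _ _) χ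
        (HasSubobjectClassifier.truth E) := by
    intro χ
    refine ⟨⟨?_⟩, ⟨PullbackCone.IsLimit.mk _ (fun s => equalizer.lift s.fst ?_) ?_ ?_ ?_⟩⟩
    · rw [equalizer.condition]; exact comp_top _
    · rw [s.condition, comp_top]
      unfold top
      congr 1
      exact Subsingleton.elim _ _
    · intro s; exact equalizer.lift_ι _ _
    · intro s; exact Subsingleton.elim _ _
    · intro s m h1 _
      rw [← cancel_mono (equalizer.ι χ (top X)), h1]; exact (equalizer.lift_ι _ _).symm
  have hφ := key φ
  have e : equalizer.ι φ (top X) ≫ ψ = equalizer.ι φ (top X) ≫ top X := by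
    have := (h (equalizer.ι φ (top X))).1 (by
      unfold Holds; rw [equalizer.condition, comp_top])
    rw [comp_top]; exact this
  have e' : equalizer.ι ψ (top X) ≫ φ = equalizer.ι ψ (top X) ≫ top X := by
    have := (h (equalizer.ι ψ (top X))).2 (by
      unfold Holds; rw [equalizer.condition, comp_top])
    rw [comp_top]; exact this
  have hψ : IsPullback (equalizer.ι φ (top X)) (Subobject.Classifier.χ₀ _ _) ψ
        (HasSubobjectClassifier.truth E) := by
    refine IsPullback.of_iso (key ψ) (e₁ := ⟨equalizer.lift _ e', equalizer.lift _ e, ?_, ?_⟩)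
      (e₂ := Iso.refl _) (e₃ := Iso.refl _) (e₄ := Iso.refl _) ?_ ?_ ?_ ?_
    · rw [← cancel_mono (equalizer.ι ψ (top X))]; simp
    · rw [← cancel_mono (equalizer.ι φ (top X))]; simp
    · simp
    · exact Subsingleton.elim _ _
    · simp
    · simp
  rw [HasSubobjectClassifier.unique _ φ hφ, HasSubobjectClassifier.unique _ ψ hψ]

lemma holds_impF {X Y : E} (φ ψ : X ⟶ Om E) (f : Y ⟶ X) :
    Holds (f ≫ impF φ ψ) ↔ ∀ {Z : E} (g : Z ⟶ Y), Holds (g ≫ f ≫ φ) → Holds (g ≫ f ≫ ψ) := by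
  unfold impF
  rw [holds_eqF]
  constructor
  · intro h Z g hg
    have : Holds ((g ≫ f) ≫ andF φ ψ) := by
      rw [Category.assoc, h]; exact hg
    rw [holds_andF] at this
    simpa using this.2
  · intro h
    apply om_le
    intro Z g
    rw [← Category.assoc, holds_andF]
    simp only [Category.assoc]
    exact ⟨fun h => h.1, fun h' => ⟨h', h g h'⟩⟩

lemma mem_setOfF {A X Y : E} (φ : A ⊗ X ⟶ Om E) (f : Y ⟶ X) (a : Y ⟶ A) :
    Mem a (f ≫ setOfF φ) ↔ Holds (lift a f ≫ φ) := by
  unfold Mem setOfF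
  have : lift a (f ≫ curry φ) ≫ (ihom.ev A).app (Om E) = lift a f ≫ φ := by
    have h : lift a (f ≫ curry φ) = lift a f ≫ A ◁ curry φ := by
      rw [lift_whiskerLeft]
    rw [h, Category.assoc, whiskerLeft_curry_ihom_ev_app]
  rw [this]

lemma holds_allF {B X Y : E} (φ : B ⊗ X ⟶ Om E) (f : Y ⟶ X) :
    Holds (f ≫ allF φ) ↔ ∀ {Z : E} (g : Z ⟶ Y) (b : Z ⟶ B), Holds (lift b (g ≫ f) ≫ φ) := by
  unfold allF
  rw [holds_eqF, ← curry_natural_left, ← curry_natural_left]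
  constructor
  · intro h Z g b
    have h2 := curry_injective h
    have : lift b (g ≫ f) ≫ φ = lift b g ≫ (B ◁ f ≫ φ) := by
      rw [← Category.assoc, lift_whiskerLeft]
    rw [this, h2]
    unfold Holds
    rw [comp_top, comp_top]
  · intro h
    congr 1
    rw [comp_top]
    have := h (snd B Y) (fst B Y)
    unfold Holds at this
    rw [← this]
    congr 1
    ext <;> simp

lemma holds_exF_of {B X Y : E} (φ : B ⊗ X ⟶ Om E) (f : Y ⟶ X) (b : Y ⟶ B)
    (h : Holds (lift b f ≫ φ)) : Holds (f ≫ exF φ) := by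
  unfold exF
  rw [holds_allF]
  intro Z g ω
  rw [holds_impF]
  intro W k hk
  rw [← Category.assoc, holds_allF] at hk
  have h1 := hk (𝟙 W) (k ≫ g ≫ b)
  have h2 := (holds_impF _ _ _).1 h1 (𝟙 W)
  have e1 : lift (k ≫ g ≫ b) (𝟙 W ≫ k ≫ lift ω (g ≫ f)) ≫ snd B _ ≫ fst (Om E) X =
      k ≫ lift ω (g ≫ f) ≫ fst _ _ := by simp
  have e2 : lift (k ≫ g ≫ b) (𝟙 W ≫ k ≫ lift ω (g ≫ f)) ≫ B ◁ snd (Om E) X ≫ φ =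
      (k ≫ g) ≫ lift b f ≫ φ := by
    simp only [← Category.assoc]
    congr 1
    ext <;> simp
  rw [e1, e2, Category.id_comp, Category.id_comp] at h2
  exact h2 (h.comp _)

lemma holds_exF_elim {B X Y : E} (φ : B ⊗ X ⟶ Om E) (f : Y ⟶ X) (ψ : Y ⟶ Om E)
    (h : Holds (f ≫ exF φ))
    (hψ : ∀ {Z : E} (g : Z ⟶ Y) (b : Z ⟶ B), Holds (lift b (g ≫ f) ≫ φ) → Holds (g ≫ ψ)) :
    Holds ψ := by
  unfold exF at h
  rw [holds_allF] at h
  have h1 := (holds_impF _ _ _).1 (h (𝟙 Y) ψ) (𝟙 Y)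
  simp only [Category.id_comp, lift_fst] at h1
  apply h1
  rw [holds_allF]
  intro Z g b
  rw [holds_impF]
  intro W k hk
  have e1 : k ≫ lift b (g ≫ lift ψ f) ≫ snd B _ ≫ fst (Om E) X = (k ≫ g) ≫ ψ := by simp
  have e2 : k ≫ lift b (g ≫ lift ψ f) ≫ B ◁ snd (Om E) X ≫ φ =
      lift (k ≫ b) ((k ≫ g) ≫ f) ≫ φ := by
    simp only [← Category.assoc]
    congr 1
    ext <;> simp
  rw [e1]
  rw [e2] at hk
  exact hψ _ _ hk

end InternalLogic

section Quantale

/-- An internal commutative quantale of the topos `E`: a commutative monoid object with an internal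
partial order `le : Q × Q ⟶ Ω` and a join operation `sup : P(Q) ⟶ Q` over which multiplication
distributes. The axioms are the interpretations, on generalized elements at all stages, of the
corresponding formulas of the internal language. -/
structure CommQuantale (E : Type u) [Category.{v} E] [CartesianMonoidalCategory E]
    [BraidedCategory E] [MonoidalClosed E] [HasSubobjectClassifier E] where
  /-- The underlying object. -/
  carrier : E
  /-- The monoid structure. -/
  [mon : MonObj carrier]
  [comm : IsCommMonObj carrier]
  /-- The order relation. -/
  le : carrier ⊗ carrier ⟶ Om E
  le_refl : ∀ {X : E} (x : X ⟶ carrier), Holds (lift x x ≫ le)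
  le_trans : ∀ {X : E} (x y z : X ⟶ carrier),
    Holds (lift x y ≫ le) → Holds (lift y z ≫ le) → Holds (lift x z ≫ le)
  le_antisymm : ∀ {X : E} (x y : X ⟶ carrier),
    Holds (lift x y ≫ le) → Holds (lift y x ≫ le) → x = y
  /-- The join of a subset. -/
  sup : PowObj carrier ⟶ carrier
  /-- `⋁ S` is the least upper bound of `S`. -/
  sup_le_iff : ∀ {X : E} (S : X ⟶ PowObj carrier) (t : X ⟶ carrier),
    Holds (lift (S ≫ sup) t ≫ le) ↔
      ∀ {Y : E} (f : Y ⟶ X) (s : Y ⟶ carrier), Mem s (f ≫ S) → Holds (lift s (f ≫ t) ≫ le)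
  /-- `q ⊗ ⋁ S` is the least upper bound of `{q ⊗ s | s ∈ S}`. -/
  mul_sup_le_iff : ∀ {X : E} (q : X ⟶ carrier) (S : X ⟶ PowObj carrier) (t : X ⟶ carrier),
    Holds (lift (q * (S ≫ sup)) t ≫ le) ↔
      ∀ {Y : E} (f : Y ⟶ X) (s : Y ⟶ carrier), Mem s (f ≫ S) →
        Holds (lift ((f ≫ q) * s) (f ≫ t) ≫ le)

attribute [instance] CommQuantale.mon CommQuantale.comm

variable {E : Type u} [Category.{v} E] [CartesianMonoidalCategory E] [BraidedCategory E]
  [MonoidalClosed E] [HasSubobjectClassifier E]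

namespace CommQuantale

/-- The order on generalized elements of an internal quantale. -/
def Le (Q : CommQuantale E) {X : E} (x y : X ⟶ Q.carrier) : Prop := Holds (lift x y ≫ Q.le)

/-- A morphism of internal commutative quantales: a homomorphism of monoid objects that preserves
joins, i.e. `h(⋁ S)` is the least upper bound of `{h(s) | s ∈ S}`. -/
@[ext]
structure Hom (Q₁ Q₂ : CommQuantale E) where
  /-- The underlying morphism. -/
  hom : Q₁.carrier ⟶ Q₂.carrier
  one_hom : MonObj.one ≫ hom = MonObj.one
  mul_hom : MonObj.mul ≫ hom = (hom ⊗ₘ hom) ≫ MonObj.mul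
  sup_hom_le_iff : ∀ {X : E} (S : X ⟶ PowObj Q₁.carrier) (t : X ⟶ Q₂.carrier),
    Q₂.Le ((S ≫ Q₁.sup) ≫ hom) t ↔
      ∀ {Y : E} (f : Y ⟶ X) (s : Y ⟶ Q₁.carrier), Mem s (f ≫ S) → Q₂.Le (s ≫ hom) (f ≫ t)

variable {Q : CommQuantale E}

lemma Le.refl {X : E} (x : X ⟶ Q.carrier) : Q.Le x x := Q.le_refl x

lemma Le.trans {X : E} {x y z : X ⟶ Q.carrier} (h : Q.Le x y) (h' : Q.Le y z) : Q.Le x z :=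
  Q.le_trans _ _ _ h h'

lemma Le.antisymm {X : E} {x y : X ⟶ Q.carrier} (h : Q.Le x y) (h' : Q.Le y x) : x = y :=
  Q.le_antisymm _ _ h h'

variable [HasFiniteLimits E]

lemma Le.comp {X Y : E} {x y : X ⟶ Q.carrier} (h : Q.Le x y) (f : Y ⟶ X) :
    Q.Le (f ≫ x) (f ≫ y) := by
  have := Holds.comp h f
  unfold Le
  rwa [← Category.assoc, comp_lift] at this

lemma eq_of_le_iff {X : E} {x y : X ⟶ Q.carrier} (h : ∀ t, Q.Le x t ↔ Q.Le y t) : x = y :=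
  Le.antisymm ((h y).2 (Le.refl y)) ((h x).1 (Le.refl x))

/-- The principal down-set `{z | z ≤ y}`. -/
def down (Q : CommQuantale E) {X : E} (y : X ⟶ Q.carrier) : X ⟶ PowObj Q.carrier :=
  setOfF (lift (fst _ X) (snd _ X ≫ y) ≫ Q.le)

lemma mem_down {X Y : E} (y : X ⟶ Q.carrier) (f : Y ⟶ X) (z : Y ⟶ Q.carrier) :
    Mem z (f ≫ Q.down y) ↔ Q.Le z (f ≫ y) := by
  unfold down
  rw [mem_setOfF, ← Category.assoc, comp_lift, lift_fst, lift_snd_assoc]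
  rfl

lemma sup_down {X : E} (y : X ⟶ Q.carrier) : Q.down y ≫ Q.sup = y := by
  apply eq_of_le_iff
  intro t
  refine (Q.sup_le_iff _ _).trans ⟨fun h => ?_, fun h Y f s hs => ?_⟩
  · have := h (𝟙 X) y ((mem_down _ _ _).2 (by rw [Category.id_comp]; exact Le.refl _))
    rwa [Category.id_comp] at this
  · exact Le.trans ((mem_down _ _ _).1 hs) (Le.comp h f)

lemma mul_le_mul_left' {X : E} (q : X ⟶ Q.carrier) {x y : X ⟶ Q.carrier} (h : Q.Le x y) :
    Q.Le (q * x) (q * y) := by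
  have := (Q.mul_sup_le_iff q (Q.down y) (q * y)).1 (by rw [sup_down]; exact Le.refl _)
    (𝟙 X) x ((mem_down _ _ _).2 (by rwa [Category.id_comp]))
  rwa [Category.id_comp, Category.id_comp] at this

lemma Le.mul {X : E} {x y x' y' : X ⟶ Q.carrier} (h : Q.Le x y) (h' : Q.Le x' y') :
    Q.Le (x * x') (y * y') := by
  refine Le.trans (mul_le_mul_left' x h') ?_
  rw [mul_comm x, mul_comm y]
  exact mul_le_mul_left' y' h

lemma Le.prod {X : E} {n : ℕ} {x y : Fin n → (X ⟶ Q.carrier)} (h : ∀ i, Q.Le (x i) (y i)) :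
    Q.Le (∏ i, x i) (∏ i, y i) := by
  induction n with
  | zero => simpa using Le.refl _
  | succ n ih =>
    rw [Fin.prod_univ_succ, Fin.prod_univ_succ]
    exact Le.mul (h 0) (ih fun i => h i.succ)

lemma comp_prod {X Y : E} {n : ℕ} (f : Y ⟶ X) (x : Fin n → (X ⟶ Q.carrier)) :
    f ≫ (∏ i, x i) = ∏ i, f ≫ x i := by
  induction n with
  | zero => simp [MonObj.comp_one]
  | succ n ih => rw [Fin.prod_univ_succ, Fin.prod_univ_succ, MonObj.comp_mul, ih]

lemma Hom.mono {Q₁ Q₂ : CommQuantale E} (h : Hom Q₁ Q₂) {X : E} {x y : X ⟶ Q₁.carrier}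
    (hxy : Q₁.Le x y) : Q₂.Le (x ≫ h.hom) (y ≫ h.hom) := by
  have := (h.sup_hom_le_iff (Q₁.down y) (y ≫ h.hom)).1 (by rw [sup_down]; exact Le.refl _)
    (𝟙 X) x ((mem_down _ _ _).2 (by rwa [Category.id_comp]))
  simpa only [Category.id_comp] using this

/-- The identity morphism of an internal quantale. -/
def Hom.id (Q : CommQuantale E) : Hom Q Q where
  hom := 𝟙 _
  one_hom := Category.comp_id _
  mul_hom := by simp
  sup_hom_le_iff S t := by
    simp only [Category.comp_id]
    exact Q.sup_le_iff S t

/-- The composite of two morphisms of internal quantales. -/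
def Hom.comp {Q₁ Q₂ Q₃ : CommQuantale E} (h : Hom Q₁ Q₂) (k : Hom Q₂ Q₃) : Hom Q₁ Q₃ where
  hom := h.hom ≫ k.hom
  one_hom := by rw [← Category.assoc, h.one_hom, k.one_hom]
  mul_hom := by
    rw [← Category.assoc, h.mul_hom, Category.assoc, k.mul_hom, ← Category.assoc,
      tensorHom_comp_tensorHom]
  sup_hom_le_iff {X} S t := by
    simp only [← Category.assoc]
    constructor
    · intro H Y f s hs
      have h1 := (h.sup_hom_le_iff S _).1 (Le.refl _) f s hs
      have h2 := k.mono h1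
      refine Le.trans h2 ?_
      have := Le.comp H f
      simpa only [Category.assoc] using this
    · intro H
      let T : X ⟶ PowObj Q₂.carrier :=
        setOfF (lift (fst _ X ≫ k.hom) (snd _ X ≫ t) ≫ Q₃.le)
      have hT : ∀ {Y : E} (f : Y ⟶ X) (z : Y ⟶ Q₂.carrier),
          Mem z (f ≫ T) ↔ Q₃.Le (z ≫ k.hom) (f ≫ t) := by
        intro Y f z
        rw [mem_setOfF, ← Category.assoc, comp_lift, lift_fst_assoc, lift_snd_assoc]
        rfl
      have h1 : Q₂.Le ((S ≫ Q₁.sup) ≫ h.hom) (T ≫ Q₂.sup) := by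
        rw [h.sup_hom_le_iff]
        intro Y f s hs
        have := (Q₂.sup_le_iff T _).1 (Le.refl _) f (s ≫ h.hom) ((hT _ _).2 (H f s hs))
        exact this
      refine Le.trans (k.mono h1) ?_
      rw [k.sup_hom_le_iff]
      intro Y f s hs
      exact (hT _ _).1 hs

/-- Internal commutative quantales and their morphisms form a category. -/
instance : Category (CommQuantale E) where
  Hom := Hom
  id := Hom.id
  comp := Hom.comp
  id_comp _ := Hom.ext (Category.id_comp _)
  comp_id _ := Hom.ext (Category.comp_id _)
  assoc _ _ _ := Hom.ext (Category.assoc _ _ _)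

/-- The join `⋁ {f(b, x) | b : B} = ⋁ {q | ∃ b : B, q = f(b, x)}` in context `X`. -/
def iSup (Q : CommQuantale E) {B X : E} (f : B ⊗ X ⟶ Q.carrier) : X ⟶ Q.carrier :=
  setOfF (A := Q.carrier) (X := X)
    (exF (B := B) (X := Q.carrier ⊗ X)
      (eqF (snd B (Q.carrier ⊗ X) ≫ fst Q.carrier X)
        (lift (fst B (Q.carrier ⊗ X)) (snd B (Q.carrier ⊗ X) ≫ snd Q.carrier X) ≫ f))) ≫ Q.sup

/-- The join `⋁ {k | φ(x)} = ⋁ {q | q = k ∧ φ(x)}` in context `X`, where `k` is the unit. -/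
def guard (Q : CommQuantale E) {X : E} (φ : X ⟶ Om E) : X ⟶ Q.carrier :=
  setOfF (A := Q.carrier) (X := X)
    (andF (eqF (fst Q.carrier X) 1) (snd Q.carrier X ≫ φ)) ≫ Q.sup

lemma mul_iSup_le_iff {B X Y : E} (f : B ⊗ X ⟶ Q.carrier) (g : Y ⟶ X) (u t : Y ⟶ Q.carrier) :
    Q.Le (u * (g ≫ Q.iSup f)) t ↔ ∀ {Z : E} (h : Z ⟶ Y) (b : Z ⟶ B),
      Q.Le ((h ≫ u) * (lift b (h ≫ g) ≫ f)) (h ≫ t) := by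
  unfold iSup
  rw [← Category.assoc]
  refine (Q.mul_sup_le_iff u _ t).trans ⟨fun H Z h b => ?_, fun H Z h s hs => ?_⟩
  · apply H h
    rw [← Category.assoc, mem_setOfF]
    apply holds_exF_of _ _ b
    rw [holds_eqF]
    simp [← Category.assoc, comp_lift]
  · rw [← Category.assoc, mem_setOfF] at hs
    refine holds_exF_elim _ _ _ hs ?_
    intro W k b hb
    rw [holds_eqF] at hb
    have e : k ≫ s = lift b ((k ≫ h) ≫ g) ≫ f := by
      have e1 : lift b (k ≫ lift s (h ≫ g)) ≫ snd B (Q.carrier ⊗ X) ≫ fst Q.carrier X = k ≫ s := by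
        simp
      rw [← e1, hb, ← Category.assoc]
      congr 1
      ext <;> simp
    have := H (k ≫ h) b
    rw [← e] at this
    unfold Le at this
    rw [← Category.assoc, comp_lift, MonObj.comp_mul]
    simpa only [Category.assoc] using this

lemma mul_guard_le_iff {X Y : E} (φ : X ⟶ Om E) (g : Y ⟶ X) (u t : Y ⟶ Q.carrier) :
    Q.Le (u * (g ≫ Q.guard φ)) t ↔ ∀ {Z : E} (h : Z ⟶ Y), Holds (h ≫ g ≫ φ) →
      Q.Le (h ≫ u) (h ≫ t) := by
  unfold guard
  rw [← Category.assoc]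
  refine (Q.mul_sup_le_iff u _ t).trans ⟨fun H Z h hφ => ?_, fun H Z h s hs => ?_⟩
  · have := H h 1 ?_
    · rw [mul_one] at this; exact this
    rw [← Category.assoc, mem_setOfF, holds_andF, holds_eqF]
    simp only [lift_fst, MonObj.comp_one, true_and, lift_snd_assoc]
    simpa only [Category.assoc] using hφ
  · rw [← Category.assoc, mem_setOfF, holds_andF, holds_eqF] at hs
    simp only [lift_fst, MonObj.comp_one, lift_snd_assoc, Category.assoc] at hs
    rw [hs.1, mul_one]
    exact H h hs.2

lemma iSup_le_iff {B X Y : E} (f : B ⊗ X ⟶ Q.carrier) (g : Y ⟶ X) (t : Y ⟶ Q.carrier) :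
    Q.Le (g ≫ Q.iSup f) t ↔ ∀ {Z : E} (h : Z ⟶ Y) (b : Z ⟶ B),
      Q.Le (lift b (h ≫ g) ≫ f) (h ≫ t) := by
  have := mul_iSup_le_iff f g 1 t
  simpa only [one_mul, MonObj.comp_one] using this

lemma guard_le_iff {X Y : E} (φ : X ⟶ Om E) (g : Y ⟶ X) (t : Y ⟶ Q.carrier) :
    Q.Le (g ≫ Q.guard φ) t ↔ ∀ {Z : E} (h : Z ⟶ Y), Holds (h ≫ g ≫ φ) →
      Q.Le 1 (h ≫ t) := by
  have := mul_guard_le_iff φ g 1 t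
  simpa only [one_mul, MonObj.comp_one] using this

end CommQuantale

end Quantale

section Relations

variable {E : Type u} [Category.{v} E] [CartesianMonoidalCategory E] [BraidedCategory E]
  [HasFiniteLimits E] [MonoidalClosed E] [HasSubobjectClassifier E]

namespace CommQuantale

variable (Q : CommQuantale E)

/-- The graph `f_∘(a, b) = ⋁ {k | f(a) = b}` of a morphism. -/
def graph {A B : E} (f : A ⟶ B) : A ⊗ B ⟶ Q.carrier := Q.guard (eqF (fst A B ≫ f) (snd A B))

/-- The identity relation `1_A(a₁, a₂) = ⋁ {k | a₁ = a₂}`. -/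
def relId (A : E) : A ⊗ A ⟶ Q.carrier := Q.guard (eqF (fst A A) (snd A A))

variable {Q}

/-- The composite relation `(S ∘ R)(a, c) = ⋁ {R(a, b) ⊗ S(b, c) | b : B}`. -/
def relComp {A B C : E} (R : A ⊗ B ⟶ Q.carrier) (S : B ⊗ C ⟶ Q.carrier) : A ⊗ C ⟶ Q.carrier :=
  Q.iSup (B := B) (X := A ⊗ C)
    ((lift (snd B (A ⊗ C) ≫ fst A C) (fst B (A ⊗ C)) ≫ R) *
      (lift (fst B (A ⊗ C)) (snd B (A ⊗ C) ≫ snd A C) ≫ S))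

/-- The tensor `(R ⊗ R')((a, a'), (b, b')) = R(a, b) ⊗ R'(a', b')` of relations. -/
def relTensor {A A' B B' : E} (R : A ⊗ B ⟶ Q.carrier) (R' : A' ⊗ B' ⟶ Q.carrier) :
    (A ⊗ A') ⊗ (B ⊗ B') ⟶ Q.carrier :=
  (lift (fst (A ⊗ A') (B ⊗ B') ≫ fst A A') (snd (A ⊗ A') (B ⊗ B') ≫ fst B B') ≫ R) *
    (lift (fst (A ⊗ A') (B ⊗ B') ≫ snd A A') (snd (A ⊗ A') (B ⊗ B') ≫ snd B B') ≫ R')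

lemma rel_ext {A B : E} {R S : A ⊗ B ⟶ Q.carrier}
    (h : ∀ {X : E} (a : X ⟶ A) (b : X ⟶ B), lift a b ≫ R = lift a b ≫ S) : R = S := by
  have := h (fst A B) (snd A B)
  simpa using this

lemma relId_eq_graph (A : E) : Q.relId A = Q.graph (𝟙 A) := by
  unfold relId graph
  rw [Category.comp_id]

lemma mul_graph_le_iff {A B X : E} (f : A ⟶ B) (a : X ⟶ A) (b : X ⟶ B) (u t : X ⟶ Q.carrier) :
    Q.Le (u * (lift a b ≫ Q.graph f)) t ↔ ∀ {Z : E} (h : Z ⟶ X), h ≫ a ≫ f = h ≫ b →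
      Q.Le (h ≫ u) (h ≫ t) := by
  unfold graph
  rw [mul_guard_le_iff]
  refine forall_congr' fun Z => forall_congr' fun h => ?_
  rw [← Category.assoc, holds_eqF]
  simp

lemma graph_le_iff {A B X : E} (f : A ⟶ B) (a : X ⟶ A) (b : X ⟶ B) (t : X ⟶ Q.carrier) :
    Q.Le (lift a b ≫ Q.graph f) t ↔ ∀ {Z : E} (h : Z ⟶ X), h ≫ a ≫ f = h ≫ b →
      Q.Le 1 (h ≫ t) := by
  have := mul_graph_le_iff f a b 1 t
  simpa only [one_mul, MonObj.comp_one] using this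

lemma one_le_graph {A B X : E} (f : A ⟶ B) (a : X ⟶ A) (b : X ⟶ B) (h : a ≫ f = b) :
    Q.Le 1 (lift a b ≫ Q.graph f) := by
  have := (graph_le_iff f a b _).1 (Le.refl (Q := Q) _) (𝟙 X) (by simpa using h)
  simpa only [Category.id_comp] using this

lemma mul_relComp_le_iff {A B C X : E} (R : A ⊗ B ⟶ Q.carrier) (S : B ⊗ C ⟶ Q.carrier)
    (a : X ⟶ A) (c : X ⟶ C) (u t : X ⟶ Q.carrier) :
    Q.Le (u * (lift a c ≫ relComp R S)) t ↔ ∀ {Z : E} (h : Z ⟶ X) (b : Z ⟶ B),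
      Q.Le ((h ≫ u) * ((lift (h ≫ a) b ≫ R) * (lift b (h ≫ c) ≫ S))) (h ≫ t) := by
  unfold relComp
  rw [mul_iSup_le_iff]
  refine forall_congr' fun Z => forall_congr' fun h => forall_congr' fun b => ?_
  rw [MonObj.comp_mul, ← Category.assoc, ← Category.assoc]
  simp only [comp_lift, lift_fst, lift_snd_assoc, lift_snd]

lemma relComp_le_iff {A B C X : E} (R : A ⊗ B ⟶ Q.carrier) (S : B ⊗ C ⟶ Q.carrier)
    (a : X ⟶ A) (c : X ⟶ C) (t : X ⟶ Q.carrier) :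
    Q.Le (lift a c ≫ relComp R S) t ↔ ∀ {Z : E} (h : Z ⟶ X) (b : Z ⟶ B),
      Q.Le ((lift (h ≫ a) b ≫ R) * (lift b (h ≫ c) ≫ S)) (h ≫ t) := by
  have := mul_relComp_le_iff R S a c 1 t
  simpa only [one_mul, MonObj.comp_one] using this

lemma le_relComp {A B C X : E} (R : A ⊗ B ⟶ Q.carrier) (S : B ⊗ C ⟶ Q.carrier)
    (a : X ⟶ A) (b : X ⟶ B) (c : X ⟶ C) :
    Q.Le ((lift a b ≫ R) * (lift b c ≫ S)) (lift a c ≫ relComp R S) := by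
  have := (relComp_le_iff R S a c _).1 (Le.refl _) (𝟙 X) b
  simpa only [Category.id_comp] using this

lemma lift_relTensor {A A' B B' X : E} (R : A ⊗ B ⟶ Q.carrier) (R' : A' ⊗ B' ⟶ Q.carrier)
    (a : X ⟶ A ⊗ A') (b : X ⟶ B ⊗ B') :
    lift a b ≫ relTensor R R' =
      (lift (a ≫ fst A A') (b ≫ fst B B') ≫ R) * (lift (a ≫ snd A A') (b ≫ snd B B') ≫ R') := by
  unfold relTensor
  rw [MonObj.comp_mul, ← Category.assoc, ← Category.assoc]
  simp only [comp_lift, lift_fst_assoc, lift_snd_assoc]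

lemma relComp_assoc {A B C D : E} (R : A ⊗ B ⟶ Q.carrier) (S : B ⊗ C ⟶ Q.carrier)
    (T : C ⊗ D ⟶ Q.carrier) : relComp (relComp R S) T = relComp R (relComp S T) := by
  apply rel_ext
  intro X a d
  apply eq_of_le_iff
  intro t
  rw [relComp_le_iff, relComp_le_iff]
  constructor
  · intro H Z h b
    rw [mul_relComp_le_iff]
    intro W k c
    have := H (k ≫ h) c
    rw [mul_comm, mul_relComp_le_iff] at this
    have := this (𝟙 W) (k ≫ b)
    simp only [Category.id_comp, Category.assoc] at this
    rw [← Category.assoc, comp_lift]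
    convert this using 1
    ac_rfl
  · intro H Z h c
    rw [mul_comm, mul_relComp_le_iff]
    intro W k b
    have := H (k ≫ h) b
    rw [mul_relComp_le_iff] at this
    have := this (𝟙 W) (k ≫ c)
    simp only [Category.id_comp, Category.assoc] at this
    rw [← Category.assoc, comp_lift]
    convert this using 1
    ac_rfl

lemma graph_relComp {A B C X : E} (f : A ⟶ B) (S : B ⊗ C ⟶ Q.carrier) (a : X ⟶ A) (c : X ⟶ C) :
    lift a c ≫ relComp (Q.graph f) S = lift (a ≫ f) c ≫ S := by
  apply Le.antisymm
  · rw [relComp_le_iff]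
    intro Z h b
    rw [mul_comm, mul_graph_le_iff]
    intro W k e
    simp only [← Category.assoc, comp_lift] at e ⊢
    rw [e]
    exact Le.refl _
  · refine Le.trans ?_ (le_relComp _ _ a (a ≫ f) c)
    have := Le.mul (one_le_graph (Q := Q) f a (a ≫ f) rfl) (Le.refl (lift (a ≫ f) c ≫ S))
    rwa [one_mul] at this

lemma relComp_graph {A B C X : E} (R : A ⊗ B ⟶ Q.carrier) (f : B ≅ C) (a : X ⟶ A) (c : X ⟶ C) :
    lift a c ≫ relComp R (Q.graph f.hom) = lift a (c ≫ f.inv) ≫ R := by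
  apply Le.antisymm
  · rw [relComp_le_iff]
    intro Z h b
    rw [mul_graph_le_iff]
    intro W k e
    have e' : k ≫ b = k ≫ h ≫ c ≫ f.inv := by
      have := congrArg (· ≫ f.inv) e
      simpa using this
    simp only [← Category.assoc, comp_lift] at e' ⊢
    rw [e']
    exact Le.refl _
  · refine Le.trans ?_ (le_relComp _ _ a (c ≫ f.inv) c)
    have := Le.mul (Le.refl (lift a (c ≫ f.inv) ≫ R))
      (one_le_graph (Q := Q) f.hom (c ≫ f.inv) c (by simp))
    rwa [mul_one] at this

lemma graph_comp_graph {A B C : E} (f : A ⟶ B) (g : B ⟶ C) :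
    relComp (Q.graph f) (Q.graph g) = Q.graph (f ≫ g) := by
  apply rel_ext
  intro X a c
  rw [graph_relComp]
  apply eq_of_le_iff
  intro t
  rw [graph_le_iff, graph_le_iff]
  simp only [Category.assoc]

lemma graph_tensor_graph {A A' B B' : E} (f : A ⟶ B) (g : A' ⟶ B') :
    relTensor (Q.graph f) (Q.graph g) = Q.graph (f ⊗ₘ g) := by
  apply rel_ext
  intro X a b
  rw [lift_relTensor]
  apply eq_of_le_iff
  intro t
  rw [mul_graph_le_iff, graph_le_iff]
  constructor
  · intro H Z h e
    have e1 := congrArg (· ≫ fst _ _) e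
    have e2 := congrArg (· ≫ snd _ _) e
    have := H h (by simpa using e2)
    rw [← Category.assoc, comp_lift, graph_le_iff] at this
    have := this (𝟙 Z) (by simpa using e1)
    simpa only [Category.id_comp] using this
  · intro H Z h e
    rw [← Category.assoc, comp_lift, graph_le_iff]
    intro W k e'
    have := H (k ≫ h) (by
      have e2 := congrArg (k ≫ ·) e
      ext
      · simpa using e'
      · simpa using e2)
    simpa only [Category.assoc] using this

lemma id_relComp {A B : E} (R : A ⊗ B ⟶ Q.carrier) : relComp (Q.relId A) R = R := by
  rw [relId_eq_graph]
  apply rel_ext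
  intro X a b
  rw [graph_relComp, Category.comp_id]

lemma relComp_id {A B : E} (R : A ⊗ B ⟶ Q.carrier) : relComp R (Q.relId B) = R := by
  rw [relId_eq_graph]
  apply rel_ext
  intro X a b
  have := relComp_graph R (Iso.refl B) a b
  simpa using this

lemma relTensor_comp {A₁ B₁ C₁ A₂ B₂ C₂ : E} (R₁ : A₁ ⊗ B₁ ⟶ Q.carrier)
    (R₂ : A₂ ⊗ B₂ ⟶ Q.carrier) (S₁ : B₁ ⊗ C₁ ⟶ Q.carrier) (S₂ : B₂ ⊗ C₂ ⟶ Q.carrier) :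
    relComp (relTensor R₁ R₂) (relTensor S₁ S₂) = relTensor (relComp R₁ S₁) (relComp R₂ S₂) := by
  apply rel_ext
  intro X a c
  rw [lift_relTensor]
  apply eq_of_le_iff
  intro t
  rw [relComp_le_iff, mul_relComp_le_iff]
  constructor
  · intro H Z h b₂
    rw [← Category.assoc, comp_lift, mul_comm, mul_relComp_le_iff]
    intro W k b₁
    have := H (k ≫ h) (lift b₁ (k ≫ b₂))
    rw [lift_relTensor, lift_relTensor] at this
    simp only [lift_fst, lift_snd, Category.assoc] at this
    simp only [MonObj.comp_mul, ← Category.assoc, comp_lift] at this ⊢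
    convert this using 1
    ac_rfl
  · intro H Z h b
    have := H h (b ≫ snd _ _)
    rw [← Category.assoc, comp_lift, mul_comm, mul_relComp_le_iff] at this
    have := this (𝟙 Z) (b ≫ fst _ _)
    rw [lift_relTensor, lift_relTensor]
    simp only [Category.id_comp] at this
    simp only [← Category.assoc] at this ⊢
    convert this using 1
    ac_rfl

lemma relComp_mono {A B C : E} {R R' : A ⊗ B ⟶ Q.carrier} {S S' : B ⊗ C ⟶ Q.carrier}
    (h : Q.Le R R') (h' : Q.Le S S') : Q.Le (relComp R S) (relComp R' S') := by
  have : Q.Le (lift (fst A C) (snd A C) ≫ relComp R S)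
      (lift (fst A C) (snd A C) ≫ relComp R' S') := by
    rw [relComp_le_iff]
    intro Z k b
    refine Le.trans (Le.mul (h.comp _) (h'.comp _)) ?_
    rw [← Category.assoc, comp_lift]
    exact le_relComp _ _ _ _ _
  simpa using this

lemma relTensor_mono {A B A' B' : E} {R S : A ⊗ B ⟶ Q.carrier} {R' S' : A' ⊗ B' ⟶ Q.carrier}
    (h : Q.Le R S) (h' : Q.Le R' S') : Q.Le (relTensor R R') (relTensor S S') :=
  Le.mul (h.comp _) (h'.comp _)

lemma prod_relComp_le {A B C : E} (R : A ⊗ B ⟶ Q.carrier) (S : B ⊗ C ⟶ Q.carrier) :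
    ∀ {n : ℕ} {X : E} (a : Fin n → (X ⟶ A)) (c : Fin n → (X ⟶ C)) (u t : X ⟶ Q.carrier),
      (∀ {Z : E} (h : Z ⟶ X) (b : Fin n → (Z ⟶ B)),
        Q.Le ((h ≫ u) * ∏ i, ((lift (h ≫ a i) (b i) ≫ R) * (lift (b i) (h ≫ c i) ≫ S)))
          (h ≫ t)) →
      Q.Le (u * ∏ i, (lift (a i) (c i) ≫ relComp R S)) t := by
  intro n
  induction n with
  | zero =>
    intro X a c u t H
    have := H (𝟙 X) (fun i => i.elim0)
    simpa using this
  | succ n ih =>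
    intro X a c u t H
    rw [Fin.prod_univ_succ, mul_left_comm, mul_comm, mul_relComp_le_iff]
    intro Z h b₀
    rw [MonObj.comp_mul, comp_prod, mul_right_comm]
    simp only [← Category.assoc, comp_lift]
    apply ih
    intro W k b
    have := H (k ≫ h) (Fin.cons (k ≫ b₀) b)
    rw [Fin.prod_univ_succ] at this
    simp only [Fin.cons_zero, Fin.cons_succ] at this
    simp only [MonObj.comp_mul, ← Category.assoc, comp_lift] at this ⊢
    rwa [← mul_assoc] at this

lemma prod_graph_le {A B : E} (f : A ⟶ B) :
    ∀ {n : ℕ} {X : E} (a : Fin n → (X ⟶ A)) (b : Fin n → (X ⟶ B)) (u t : X ⟶ Q.carrier),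
      (∀ {Z : E} (h : Z ⟶ X), (∀ i, h ≫ a i ≫ f = h ≫ b i) → Q.Le (h ≫ u) (h ≫ t)) →
      Q.Le (u * ∏ i, (lift (a i) (b i) ≫ Q.graph f)) t := by
  intro n
  induction n with
  | zero =>
    intro X a c u t H
    have := H (𝟙 X) (fun i => i.elim0)
    simpa using this
  | succ n ih =>
    intro X a b u t H
    rw [Fin.prod_univ_succ, mul_left_comm, mul_comm, mul_graph_le_iff]
    intro Z h e
    rw [MonObj.comp_mul, comp_prod]
    simp only [← Category.assoc, comp_lift]
    apply ih
    intro W k e'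
    have := H (k ≫ h) (Fin.cases (by simpa using congrArg (k ≫ ·) e)
      (fun i => by simpa using e' i))
    simpa only [Category.assoc] using this

end CommQuantale

end Relations

section Algebras

/-- An algebraic signature: a set of operation symbols of finite arity. -/
structure Signature where
  /-- The operation symbols. -/
  Op : Type w
  /-- The arity of an operation symbol. -/
  arity : Op → ℕ

/-- Terms over a signature in the variables `x₀, …, xₙ₋₁`. -/
inductive Term (S : Signature.{w}) (n : ℕ) : Type w
  | var (i : Fin n) : Term S n
  | app (σ : S.Op) (args : Fin (S.arity σ) → Term S n) : Term S n

/-- A presentation `(Σ, E)` of an algebraic variety: a signature with a set of equations, each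
between two terms in the same finite context of variables. -/
structure Variety extends Signature.{w} where
  /-- The equations. -/
  eqns : Set (Σ n : ℕ, Term toSignature n × Term toSignature n)

variable {E : Type u} [Category.{v} E] [CartesianMonoidalCategory E] [HasFiniteProducts E]

/-- The value of a term on generalized elements, for an interpretation `op` of the operations. -/
def Term.eval {S : Signature.{w}} {A : E}
    (op : ∀ σ : S.Op, (∏ᶜ fun _ : Fin (S.arity σ) => A) ⟶ A) {X : E} {n : ℕ}
    (ρ : Fin n → (X ⟶ A)) : Term S n → (X ⟶ A)
  | .var i => ρ i
  | .app σ args => Pi.lift (fun i => (args i).eval op ρ) ≫ op σ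

/-- A `(Σ, E)`-algebra in the category `E`. -/
structure Algebra (V : Variety.{w}) (E : Type u) [Category.{v} E] [HasFiniteProducts E] where
  /-- The underlying object. -/
  carrier : E
  /-- The operations `Aⁿ ⟶ A`. -/
  op : ∀ σ : V.Op, (∏ᶜ fun _ : Fin (V.arity σ) => carrier) ⟶ carrier
  sat : ∀ e ∈ V.eqns, ∀ {X : E} (ρ : Fin e.1 → (X ⟶ carrier)),
    Term.eval op ρ e.2.1 = Term.eval op ρ e.2.2

namespace Algebra

variable {V : Variety.{w}}

/-- The value `σ(a₁, …, aₙ)` of an operation on generalized elements. -/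
def ap (A : Algebra V E) (σ : V.Op) {X : E} (a : Fin (V.arity σ) → (X ⟶ A.carrier)) :
    X ⟶ A.carrier := Pi.lift a ≫ A.op σ

lemma comp_ap (A : Algebra V E) (σ : V.Op) {X Y : E} (f : Y ⟶ X)
    (a : Fin (V.arity σ) → (X ⟶ A.carrier)) : f ≫ A.ap σ a = A.ap σ (fun i => f ≫ a i) := by
  unfold ap
  rw [← Category.assoc]
  congr 1
  apply Pi.hom_ext
  intro i
  simp

/-- A morphism of the underlying objects that is a homomorphism of algebras. -/
def IsHom (A B : Algebra V E) (f : A.carrier ⟶ B.carrier) : Prop :=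
  ∀ (σ : V.Op) {X : E} (a : Fin (V.arity σ) → (X ⟶ A.carrier)),
    A.ap σ a ≫ f = B.ap σ (fun i => a i ≫ f)

lemma eval_comp {S : Signature.{w}} {A B : E}
    (opA : ∀ σ : S.Op, (∏ᶜ fun _ : Fin (S.arity σ) => A) ⟶ A)
    (opB : ∀ σ : S.Op, (∏ᶜ fun _ : Fin (S.arity σ) => B) ⟶ B) (f : A ⟶ B)
    (hf : ∀ (σ : S.Op) {X : E} (a : Fin (S.arity σ) → (X ⟶ A)),
      (Pi.lift a ≫ opA σ) ≫ f = Pi.lift (fun i => a i ≫ f) ≫ opB σ)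
    {X : E} {n : ℕ} (ρ : Fin n → (X ⟶ A)) (t : Term S n) :
    t.eval opA ρ ≫ f = t.eval opB (fun i => ρ i ≫ f) := by
  induction t with
  | var i => rfl
  | app σ args ih =>
    simp only [Term.eval]
    rw [hf]
    simp only [ih]

/-- The product of two algebras, with componentwise operations. -/
abbrev prod (A B : Algebra V E) : Algebra V E where
  carrier := A.carrier ⊗ B.carrier
  op σ := lift (Pi.lift (fun i => Pi.π _ i ≫ fst A.carrier B.carrier) ≫ A.op σ)
    (Pi.lift (fun i => Pi.π _ i ≫ snd A.carrier B.carrier) ≫ B.op σ)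
  sat e he X ρ := by
    apply CartesianMonoidalCategory.hom_ext
    · rw [eval_comp _ A.op, eval_comp _ A.op, A.sat e he]
      all_goals
        intro σ X a
        rw [Category.assoc, lift_fst, ← Category.assoc]
        congr 1
        apply Pi.hom_ext
        intro i
        simp
    · rw [eval_comp _ B.op, eval_comp _ B.op, B.sat e he]
      all_goals
        intro σ X a
        rw [Category.assoc, lift_snd, ← Category.assoc]
        congr 1
        apply Pi.hom_ext
        intro i
        simp

/-- The terminal algebra. -/
abbrev unit (V : Variety.{w}) (E : Type u) [Category.{v} E] [CartesianMonoidalCategory E]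
    [HasFiniteProducts E] : Algebra V E where
  carrier := 𝟙_ E
  op _ := toUnit _
  sat _ _ _ _ := toUnit_unique _ _

lemma isHom_id (A : Algebra V E) : IsHom A A (𝟙 A.carrier) := by
  intro σ X a
  simp only [Category.comp_id]

lemma isHom_comp {A B C : Algebra V E} {f : A.carrier ⟶ B.carrier} {g : B.carrier ⟶ C.carrier}
    (hf : IsHom A B f) (hg : IsHom B C g) : IsHom A C (f ≫ g) := by
  intro σ X a
  rw [← Category.assoc, hf, hg]
  simp only [Category.assoc]

lemma isHom_fst (A B : Algebra V E) : IsHom (A.prod B) A (fst A.carrier B.carrier) := by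
  intro σ X a
  change (Pi.lift a ≫ lift _ _) ≫ fst _ _ = _
  rw [Category.assoc, lift_fst, ← Category.assoc]
  unfold ap
  congr 1
  apply Pi.hom_ext
  intro i
  simp

lemma isHom_snd (A B : Algebra V E) : IsHom (A.prod B) B (snd A.carrier B.carrier) := by
  intro σ X a
  change (Pi.lift a ≫ lift _ _) ≫ snd _ _ = _
  rw [Category.assoc, lift_snd, ← Category.assoc]
  unfold ap
  congr 1
  apply Pi.hom_ext
  intro i
  simp

lemma isHom_lift {A B C : Algebra V E} {f : A.carrier ⟶ B.carrier} {g : A.carrier ⟶ C.carrier}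
    (hf : IsHom A B f) (hg : IsHom A C g) : IsHom A (B.prod C) (lift f g) := by
  intro σ X a
  apply CartesianMonoidalCategory.hom_ext
  · rw [Category.assoc, lift_fst, hf, isHom_fst]
    simp
  · rw [Category.assoc, lift_snd, hg, isHom_snd]
    simp

lemma isHom_toUnit (A : Algebra V E) : IsHom A (unit V E) (toUnit A.carrier) :=
  fun _ _ _ => toUnit_unique _ _

lemma isHom_associator_hom (A B C : Algebra V E) :
    IsHom ((A.prod B).prod C) (A.prod (B.prod C)) (α_ A.carrier B.carrier C.carrier).hom := by
  have h := isHom_lift (isHom_comp (isHom_fst (A.prod B) C) (isHom_fst A B))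
    (isHom_lift (isHom_comp (isHom_fst (A.prod B) C) (isHom_snd A B)) (isHom_snd (A.prod B) C))
  suffices e : (α_ A.carrier B.carrier C.carrier).hom =
      lift (fst _ _ ≫ fst _ _) (lift (fst _ _ ≫ snd _ _) (snd _ _)) by
    rw [e]
    exact h
  apply CartesianMonoidalCategory.hom_ext
  · exact (associator_hom_fst _ _ _).trans (lift_fst _ _).symm
  · refine Eq.trans ?_ (lift_snd _ _).symm
    apply CartesianMonoidalCategory.hom_ext
    · exact (Category.assoc _ _ _).trans
        ((associator_hom_snd_fst _ _ _).trans (lift_fst _ _).symm)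
    · exact (Category.assoc _ _ _).trans
        ((associator_hom_snd_snd _ _ _).trans (lift_snd _ _).symm)

lemma isHom_inv {A B : Algebra V E} (e : A.carrier ≅ B.carrier) (h : IsHom A B e.hom) :
    IsHom B A e.inv := by
  intro σ X b
  rw [← cancel_mono e.hom, Category.assoc, e.inv_hom_id, Category.comp_id, h]
  simp

lemma isHom_leftUnitor_hom (A : Algebra V E) :
    IsHom ((unit V E).prod A) A (λ_ A.carrier).hom := by
  have h := isHom_snd (unit V E) A
  rwa [show snd (unit V E).carrier A.carrier = (λ_ A.carrier).hom from
    (leftUnitor_hom _).symm] at h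

lemma isHom_rightUnitor_hom (A : Algebra V E) :
    IsHom (A.prod (unit V E)) A (ρ_ A.carrier).hom := by
  have h := isHom_fst A (unit V E)
  rwa [show fst A.carrier (unit V E).carrier = (ρ_ A.carrier).hom from
    (rightUnitor_hom _).symm] at h

lemma isHom_braiding_hom [BraidedCategory E] (A B : Algebra V E) :
    IsHom (A.prod B) (B.prod A) (β_ A.carrier B.carrier).hom := by
  have h := isHom_lift (isHom_snd A B) (isHom_fst A B)
  rwa [lift_snd_fst] at h

end Algebra

end Algebras

section AlgebraicRelations

variable {E : Type u} [Category.{v} E] [CartesianMonoidalCategory E] [BraidedCategory E]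
  [HasFiniteLimits E] [MonoidalClosed E] [HasSubobjectClassifier E] {V : Variety.{w}}

open CommQuantale

/-- An algebraic `Q`-relation between `(Σ, E)`-algebras: a morphism `R : A × B ⟶ Q` such that
`R(a₁, b₁) ⊗ ⋯ ⊗ R(aₙ, bₙ) ≤ R(σ(a₁, …, aₙ), σ(b₁, …, bₙ))` for every operation `σ`. -/
@[ext]
structure AlgRel (Q : CommQuantale E) (A B : Algebra V E) where
  /-- The underlying relation. -/
  rel : A.carrier ⊗ B.carrier ⟶ Q.carrier
  algebraic : ∀ (σ : V.Op) {X : E} (a : Fin (V.arity σ) → (X ⟶ A.carrier))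
    (b : Fin (V.arity σ) → (X ⟶ B.carrier)),
    Q.Le (∏ i, (lift (a i) (b i) ≫ rel)) (lift (A.ap σ a) (B.ap σ b) ≫ rel)

namespace AlgRel

variable {Q : CommQuantale E}

/-- The graph of a homomorphism of algebras is an algebraic relation. -/
def graph (Q : CommQuantale E) {A B : Algebra V E} (f : A.carrier ⟶ B.carrier)
    (hf : Algebra.IsHom A B f) : AlgRel Q A B where
  rel := Q.graph f
  algebraic σ X a b := by
    have := prod_graph_le (Q := Q) f a b 1 (lift (A.ap σ a) (B.ap σ b) ≫ Q.graph f) ?_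
    · simpa only [one_mul] using this
    · intro Z h e
      rw [MonObj.comp_one, ← Category.assoc, comp_lift, Algebra.comp_ap, Algebra.comp_ap]
      apply one_le_graph
      rw [hf]
      simp only [Category.assoc, e]

/-- The identity relation of an algebra. -/
protected def id (Q : CommQuantale E) (A : Algebra V E) : AlgRel Q A A where
  rel := Q.relId A.carrier
  algebraic := by
    rw [relId_eq_graph]
    exact (graph Q _ A.isHom_id).algebraic

/-- The composite of algebraic relations. -/
protected def comp {A B C : Algebra V E} (R : AlgRel Q A B) (S : AlgRel Q B C) :
    AlgRel Q A C where
  rel := relComp R.rel S.rel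
  algebraic σ X a c := by
    have := prod_relComp_le R.rel S.rel a c 1
      (lift (A.ap σ a) (C.ap σ c) ≫ relComp R.rel S.rel) ?_
    · simpa only [one_mul] using this
    · intro Z h b
      rw [MonObj.comp_one, one_mul, Finset.prod_mul_distrib, ← Category.assoc, comp_lift,
        Algebra.comp_ap, Algebra.comp_ap]
      exact Le.trans (Le.mul (R.algebraic σ _ b) (S.algebraic σ b _)) (le_relComp _ _ _ _ _)

/-- The tensor product of algebraic relations. -/
protected def tensor {A A' B B' : Algebra V E} (R : AlgRel Q A B) (R' : AlgRel Q A' B') :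
    AlgRel Q (A.prod A') (B.prod B') where
  rel := relTensor R.rel R'.rel
  algebraic σ X a b := by
    have e : ∀ i, lift (a i) (b i) ≫ relTensor R.rel R'.rel = _ :=
      fun i => lift_relTensor R.rel R'.rel (a i) (b i)
    simp only [e]
    rw [Finset.prod_mul_distrib]
    refine Le.trans (Le.mul (R.algebraic σ _ _) (R'.algebraic σ _ _)) ?_
    have := lift_relTensor R.rel R'.rel ((A.prod A').ap σ a) ((B.prod B').ap σ b)
    rw [Algebra.isHom_fst A A' σ a, Algebra.isHom_fst B B' σ b,
      Algebra.isHom_snd A A' σ a, Algebra.isHom_snd B B' σ b] at this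
    rw [this]
    exact Le.refl _

end AlgRel

/-- The category `Rel_{(Σ, E)}(Q)`: its objects are the `(Σ, E)`-algebras and its morphisms the
algebraic `Q`-relations. -/
@[ext]
structure RelCat (V : Variety.{w}) (Q : CommQuantale E) where
  /-- The underlying algebra. -/
  alg : Algebra V E

namespace RelCat

variable {Q : CommQuantale E}

instance : Category (RelCat V Q) where
  Hom A B := AlgRel Q A.alg B.alg
  id A := AlgRel.id Q A.alg
  comp R S := AlgRel.comp R S
  id_comp R := AlgRel.ext (id_relComp R.rel)
  comp_id R := AlgRel.ext (relComp_id R.rel)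
  assoc R S T := AlgRel.ext (relComp_assoc R.rel S.rel T.rel)

/-- The isomorphism given by the graph of an isomorphism of algebras. -/
def isoGraph {A B : RelCat V Q} (e : A.alg.carrier ≅ B.alg.carrier)
    (h : Algebra.IsHom A.alg B.alg e.hom) : A ≅ B where
  hom := AlgRel.graph Q e.hom h
  inv := AlgRel.graph Q e.inv (Algebra.isHom_inv e h)
  hom_inv_id := AlgRel.ext <| by
    refine (graph_comp_graph e.hom e.inv).trans ?_
    rw [e.hom_inv_id]
    exact (relId_eq_graph _).symm
  inv_hom_id := AlgRel.ext <| by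
    refine (graph_comp_graph e.inv e.hom).trans ?_
    rw [e.inv_hom_id]
    exact (relId_eq_graph _).symm

/-- The tensor product is the product of algebras on objects; the unit is the terminal algebra and
the structure isomorphisms are the graphs of the structure isomorphisms of the finite products. -/
instance : MonoidalCategoryStruct (RelCat V Q) where
  tensorObj A B := ⟨A.alg.prod B.alg⟩
  whiskerLeft A {_ _} R := AlgRel.tensor (AlgRel.id Q A.alg) R
  whiskerRight {_ _} R B := AlgRel.tensor R (AlgRel.id Q B.alg)
  tensorHom R S := AlgRel.tensor R S
  tensorUnit := ⟨Algebra.unit V E⟩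
  associator A B C := isoGraph (α_ A.alg.carrier B.alg.carrier C.alg.carrier)
    (Algebra.isHom_associator_hom A.alg B.alg C.alg)
  leftUnitor A := isoGraph (λ_ A.alg.carrier) (Algebra.isHom_leftUnitor_hom A.alg)
  rightUnitor A := isoGraph (ρ_ A.alg.carrier) (Algebra.isHom_rightUnitor_hom A.alg)

lemma relTensor_id (A B : E) :
    relTensor (Q.relId A) (Q.relId B) = Q.relId (A ⊗ B) := by
  rw [relId_eq_graph, relId_eq_graph, relId_eq_graph, graph_tensor_graph, id_tensorHom_id]

/-- A commuting square of relations along graphs of isomorphisms. -/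
lemma graph_square {A A' B B' : E} (R : A ⊗ B ⟶ Q.carrier) (R' : A' ⊗ B' ⟶ Q.carrier)
    (e : A ≅ A') (e' : B ≅ B')
    (h : ∀ {X : E} (a : X ⟶ A) (b : X ⟶ B), lift a b ≫ R = lift (a ≫ e.hom) (b ≫ e'.hom) ≫ R') :
    relComp R (Q.graph e'.hom) = relComp (Q.graph e.hom) R' := by
  apply rel_ext
  intro X a b
  rw [relComp_graph, graph_relComp, h]
  simp

lemma graph_pentagon (A B C D : E) :
    relComp (relTensor (Q.graph (α_ A B C).hom) (Q.relId D))
      (relComp (Q.graph (α_ A (B ⊗ C) D).hom) (relTensor (Q.relId A) (Q.graph (α_ B C D).hom))) =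
        relComp (Q.graph (α_ (A ⊗ B) C D).hom) (Q.graph (α_ A B (C ⊗ D)).hom) := by
  rw [relId_eq_graph, relId_eq_graph, graph_tensor_graph, graph_tensor_graph, graph_comp_graph,
    graph_comp_graph, graph_comp_graph, tensorHom_id, id_tensorHom, MonoidalCategory.pentagon]

lemma graph_triangle (A B : E) :
    relComp (Q.graph (α_ A (𝟙_ E) B).hom) (relTensor (Q.relId A) (Q.graph (λ_ B).hom)) =
      relTensor (Q.graph (ρ_ A).hom) (Q.relId B) := by
  rw [relId_eq_graph, relId_eq_graph, graph_tensor_graph, graph_tensor_graph, graph_comp_graph,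
    tensorHom_id, id_tensorHom, MonoidalCategory.triangle]

lemma graph_hexagon_forward (A B C : E) :
    relComp (Q.graph (α_ A B C).hom)
      (relComp (Q.graph (β_ A (B ⊗ C)).hom) (Q.graph (α_ B C A).hom)) =
    relComp (relTensor (Q.graph (β_ A B).hom) (Q.relId C))
      (relComp (Q.graph (α_ B A C).hom) (relTensor (Q.relId B) (Q.graph (β_ A C).hom))) := by
  rw [relId_eq_graph, relId_eq_graph, graph_tensor_graph, graph_tensor_graph]
  simp only [graph_comp_graph]
  rw [tensorHom_id, id_tensorHom, BraidedCategory.hexagon_forward]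

lemma graph_hexagon_reverse (A B C : E) :
    relComp (Q.graph (α_ A B C).inv)
      (relComp (Q.graph (β_ (A ⊗ B) C).hom) (Q.graph (α_ C A B).inv)) =
    relComp (relTensor (Q.relId A) (Q.graph (β_ B C).hom))
      (relComp (Q.graph (α_ A C B).inv) (relTensor (Q.graph (β_ A C).hom) (Q.relId B))) := by
  rw [relId_eq_graph, relId_eq_graph, graph_tensor_graph, graph_tensor_graph]
  simp only [graph_comp_graph]
  rw [tensorHom_id, id_tensorHom, BraidedCategory.hexagon_reverse]

lemma graph_symmetry (A B : E) :
    relComp (Q.graph (β_ A B).hom) (Q.graph (β_ B A).hom) = Q.relId (A ⊗ B) := by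
  rw [graph_comp_graph, relId_eq_graph, SymmetricCategory.symmetry]

instance : MonoidalCategory (RelCat V Q) := MonoidalCategory.ofTensorHom
  (id_tensorHom_id := fun A B => AlgRel.ext (relTensor_id A.alg.carrier B.alg.carrier))
  (id_tensorHom := fun _ _ _ _ => rfl)
  (tensorHom_id := fun _ _ => rfl)
  (tensorHom_comp_tensorHom := fun R₁ R₂ S₁ S₂ =>
    AlgRel.ext (relTensor_comp R₁.rel R₂.rel S₁.rel S₂.rel))
  (associator_naturality := fun {A₁ A₂ A₃ B₁ B₂ B₃} R₁ R₂ R₃ => AlgRel.ext <| by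
    refine graph_square (Q := Q) (relTensor (relTensor R₁.rel R₂.rel) R₃.rel)
      (relTensor R₁.rel (relTensor R₂.rel R₃.rel)) (α_ _ _ _) (α_ _ _ _) ?_
    intro X a b
    simp only [lift_relTensor, Category.assoc, associator_hom_fst, associator_hom_snd_fst,
      associator_hom_snd_snd, mul_assoc])
  (leftUnitor_naturality := fun {A B} R => AlgRel.ext <| by
    refine graph_square (Q := Q) (relTensor (Q.relId (𝟙_ E)) R.rel) R.rel (λ_ _) (λ_ _) ?_
    intro X a b
    rw [lift_relTensor, relId_eq_graph, leftUnitor_hom, leftUnitor_hom]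
    refine Eq.trans ?_ (one_mul _)
    congr 1
    apply Le.antisymm
    · rw [graph_le_iff]
      intro Z h _
      rw [MonObj.comp_one]
      exact Le.refl _
    · exact one_le_graph _ _ _ (toUnit_unique _ _))
  (rightUnitor_naturality := fun {A B} R => AlgRel.ext <| by
    refine graph_square (Q := Q) (relTensor R.rel (Q.relId (𝟙_ E))) R.rel (ρ_ _) (ρ_ _) ?_
    intro X a b
    rw [lift_relTensor, relId_eq_graph, rightUnitor_hom, rightUnitor_hom]
    refine Eq.trans ?_ (mul_one _)
    congr 1
    apply Le.antisymm
    · rw [graph_le_iff]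
      intro Z h _
      rw [MonObj.comp_one]
      exact Le.refl _
    · exact one_le_graph _ _ _ (toUnit_unique _ _))
  (pentagon := fun A B C D => AlgRel.ext <|
    graph_pentagon A.alg.carrier B.alg.carrier C.alg.carrier D.alg.carrier)
  (triangle := fun A B => AlgRel.ext <| graph_triangle A.alg.carrier B.alg.carrier)

/-- The symmetry is the graph of the symmetry of the finite products. -/
instance : SymmetricCategory (RelCat V Q) where
  braiding A B := isoGraph (A := A ⊗ B) (B := B ⊗ A) (β_ A.alg.carrier B.alg.carrier)
    (Algebra.isHom_braiding_hom A.alg B.alg)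
  braiding_naturality_right A {B C} R := AlgRel.ext <| by
    refine graph_square (Q := Q) (relTensor (Q.relId A.alg.carrier) R.rel)
      (relTensor R.rel (Q.relId A.alg.carrier)) (β_ _ _) (β_ _ _) ?_
    intro X a b
    simp only [lift_relTensor, Category.assoc, braiding_hom_fst, braiding_hom_snd]
    exact mul_comm _ _
  braiding_naturality_left {A B} R C := AlgRel.ext <| by
    refine graph_square (Q := Q) (relTensor R.rel (Q.relId C.alg.carrier))
      (relTensor (Q.relId C.alg.carrier) R.rel) (β_ _ _) (β_ _ _) ?_
    intro X a b
    simp only [lift_relTensor, Category.assoc, braiding_hom_fst, braiding_hom_snd]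
    exact mul_comm _ _
  hexagon_forward A B C := AlgRel.ext <|
    graph_hexagon_forward A.alg.carrier B.alg.carrier C.alg.carrier
  hexagon_reverse A B C := AlgRel.ext <|
    graph_hexagon_reverse A.alg.carrier B.alg.carrier C.alg.carrier
  symmetry A B := AlgRel.ext <| graph_symmetry A.alg.carrier B.alg.carrier

end RelCat

end AlgebraicRelations

section Enrichment

/-- A `Pos`-enriched (partially ordered) symmetric monoidal category: the hom-sets are partially
ordered, and composition and tensor product are monotone in both arguments. -/
class PosMonoidal (C : Type u) [Category.{v} C] [MonoidalCategory C] where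
  /-- The order on the hom-sets. -/
  homOrder (X Y : C) : PartialOrder (X ⟶ Y)
  comp_le_comp {X Y Z : C} {f f' : X ⟶ Y} {g g' : Y ⟶ Z} :
    f ≤ f' → g ≤ g' → f ≫ g ≤ f' ≫ g'
  tensor_le_tensor {X Y X' Y' : C} {f f' : X ⟶ Y} {g g' : X' ⟶ Y'} :
    f ≤ f' → g ≤ g' → f ⊗ₘ g ≤ f' ⊗ₘ g'

attribute [reducible, instance] PosMonoidal.homOrder

/-- A `Pos`-functor: a functor that is monotone on hom-sets. -/
def IsPosFunctor {C D : Type*} [Category* C] [MonoidalCategory C] [PosMonoidal C]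
    [Category* D] [MonoidalCategory D] [PosMonoidal D] (F : C ⥤ D) : Prop :=
  ∀ {X Y : C} (f g : X ⟶ Y), f ≤ g → F.map f ≤ F.map g

/-- A strict symmetric monoidal functor: a symmetric monoidal functor whose structure morphisms
`𝟙 ⟶ F 𝟙` and `F X ⊗ F Y ⟶ F (X ⊗ Y)` are identities. -/
def IsStrictSymmetricMonoidal {C D : Type*} [Category* C] [MonoidalCategory C]
    [SymmetricCategory C] [Category* D] [MonoidalCategory D] [SymmetricCategory D]
    (F : C ⥤ D) : Prop :=
  ∃ _ : F.Braided, (∃ e, Functor.LaxMonoidal.ε F = eqToHom e) ∧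
    ∀ X Y : C, ∃ e, Functor.LaxMonoidal.μ F X Y = eqToHom e

variable {E : Type u} [Category.{v} E] [CartesianMonoidalCategory E] [BraidedCategory E]
  [HasFiniteLimits E] [MonoidalClosed E] [HasSubobjectClassifier E] {V : Variety.{w}}
  {Q : CommQuantale E}

/-- Algebraic relations are ordered by `R ⊆ R'` iff `R(a, b) ≤ R'(a, b)` for all `a`, `b`. -/
instance (A B : Algebra V E) : PartialOrder (AlgRel Q A B) where
  le R R' := ∀ {X : E} (a : X ⟶ A.carrier) (b : X ⟶ B.carrier),
    Q.Le (lift a b ≫ R.rel) (lift a b ≫ R'.rel)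
  le_refl R X a b := CommQuantale.Le.refl _
  le_trans R S T h h' X a b := CommQuantale.Le.trans (h a b) (h' a b)
  le_antisymm R S h h' := AlgRel.ext <| CommQuantale.rel_ext fun a b =>
    CommQuantale.Le.antisymm (h a b) (h' a b)

lemma AlgRel.le_iff {A B : Algebra V E} {R R' : AlgRel Q A B} :
    R ≤ R' ↔ Q.Le R.rel R'.rel := by
  constructor
  · intro h
    have := h (fst _ _) (snd _ _)
    simpa using this
  · intro h X a b
    exact h.comp _

instance : PosMonoidal (RelCat V Q) where
  homOrder A B := inferInstanceAs (PartialOrder (AlgRel Q A.alg B.alg))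
  comp_le_comp h h' := AlgRel.le_iff.2
    (CommQuantale.relComp_mono (AlgRel.le_iff.1 h) (AlgRel.le_iff.1 h'))
  tensor_le_tensor h h' := AlgRel.le_iff.2
    (CommQuantale.relTensor_mono (AlgRel.le_iff.1 h) (AlgRel.le_iff.1 h'))

end Enrichment

end QRel

end

/-!
Preserving joins means having an internal right adjoint: `h q ≤ t ↔ q ≤ r t`, where
`r t = ⋁ {q | h q ≤ t}`. Transposing along this adjunction shows that `h` commutes with the joins
`⋁ {k | φ}` and `⋁_b f(b)`, out of which graphs, identities and composites of relations are built;
tensors and the algebraicity condition use only that `h` is a monotone monoid homomorphism. The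
objects of `Rel(Q)` do not depend on `Q`, and its structure isomorphisms are graphs of maps that
do not depend on `Q`, so postcomposition with `h` preserves the symmetric monoidal structure on the
nose.
-/

namespace QRel

section StrictSymmetricMonoidal

variable {C D : Type*} [Category* C] [MonoidalCategory C] [SymmetricCategory C]
  [Category* D] [MonoidalCategory D] [SymmetricCategory D]

lemma isStrictSymmetricMonoidal_of_heq (F : C ⥤ D) (unit_eq : 𝟙_ D = F.obj (𝟙_ C))
    (tensor_eq : ∀ X Y, F.obj X ⊗ F.obj Y = F.obj (X ⊗ Y))
    (map_whiskerLeft : ∀ (X : C) {Y Z : C} (f : Y ⟶ Z), F.map (X ◁ f) ≍ F.obj X ◁ F.map f)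
    (map_whiskerRight : ∀ {X Y : C} (f : X ⟶ Y) (Z : C), F.map (f ▷ Z) ≍ F.map f ▷ F.obj Z)
    (map_associator : ∀ X Y Z,
      F.map (α_ X Y Z).hom ≍ (α_ (F.obj X) (F.obj Y) (F.obj Z)).hom)
    (map_leftUnitor : ∀ X, F.map (λ_ X).hom ≍ (λ_ (F.obj X)).hom)
    (map_rightUnitor : ∀ X, F.map (ρ_ X).hom ≍ (ρ_ (F.obj X)).hom)
    (map_braiding : ∀ X Y, F.map (β_ X Y).hom ≍ (β_ (F.obj X) (F.obj Y)).hom) :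
    IsStrictSymmetricMonoidal F := by
  let core : F.CoreMonoidal :=
    { εIso := eqToIso unit_eq
      μIso := fun X Y => eqToIso (tensor_eq X Y)
      μIso_hom_natural_left := fun f Z => eq_of_heq <| by
        simpa [-heq_eq_eq] using (map_whiskerRight f Z).symm
      μIso_hom_natural_right := fun X f => eq_of_heq <| by
        simpa [-heq_eq_eq] using (map_whiskerLeft X f).symm
      associativity := fun X Y Z => eq_of_heq <| by
        simpa [-heq_eq_eq, eqToHom_whiskerRight, whiskerLeft_eqToHom] using map_associator X Y Z
      left_unitality := fun X => eq_of_heq <| by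
        simpa [-heq_eq_eq, eqToHom_whiskerRight] using (map_leftUnitor X).symm
      right_unitality := fun X => eq_of_heq <| by
        simpa [-heq_eq_eq, whiskerLeft_eqToHom] using (map_rightUnitor X).symm }
  have braided (X Y : C) : eqToHom (tensor_eq X Y) ≫ F.map (β_ X Y).hom =
      (β_ (F.obj X) (F.obj Y)).hom ≫ eqToHom (tensor_eq Y X) := eq_of_heq <| by
    simpa [-heq_eq_eq] using map_braiding X Y
  exact ⟨{ core.toMonoidal with braided }, ⟨unit_eq, rfl⟩, fun X Y => ⟨tensor_eq X Y, rfl⟩⟩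

end StrictSymmetricMonoidal

section QuantaleMorphisms

variable {E : Type u} [Category.{v} E] [CartesianMonoidalCategory E] [BraidedCategory E]
  [MonoidalClosed E] [HasSubobjectClassifier E]

namespace CommQuantale.Hom

variable {Q₁ Q₂ : CommQuantale E} (h : Hom Q₁ Q₂)

instance : IsMonHom h.hom := ⟨h.one_hom, h.mul_hom⟩

lemma prod_comp_hom {X : E} {J : Type*} (s : Finset J) (x : J → (X ⟶ Q₁.carrier)) :
    (∏ i ∈ s, x i) ≫ h.hom = ∏ i ∈ s, x i ≫ h.hom :=
  map_prod (IsMonHom.monoidHom h.hom X) x s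

lemma relTensor_comp_hom {A A' B B' : E} (R : A ⊗ B ⟶ Q₁.carrier) (R' : A' ⊗ B' ⟶ Q₁.carrier) :
    relTensor R R' ≫ h.hom = relTensor (R ≫ h.hom) (R' ≫ h.hom) := by
  simp only [relTensor, MonObj.mul_comp, Category.assoc]

/-- The subset `{q | h q ≤ t}` as a function of `t`; its join is the value at `t` of the right
adjoint of `h`. -/
noncomputable def sublevel : Q₂.carrier ⟶ PowObj Q₁.carrier :=
  setOfF (lift (fst Q₁.carrier Q₂.carrier ≫ h.hom) (snd Q₁.carrier Q₂.carrier) ≫ Q₂.le)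

/-- The internal right adjoint `t ↦ ⋁ {q | h q ≤ t}` of a morphism of quantales. -/
noncomputable def rightAdjoint : Q₂.carrier ⟶ Q₁.carrier :=
  h.sublevel ≫ Q₁.sup

variable [HasFiniteLimits E]

lemma mem_comp_sublevel {X : E} (t : X ⟶ Q₂.carrier) (q : X ⟶ Q₁.carrier) :
    Mem q (t ≫ h.sublevel) ↔ Q₂.Le (q ≫ h.hom) t := by
  rw [sublevel, mem_setOfF, ← Category.assoc, comp_lift, lift_fst_assoc, lift_snd]
  rfl

lemma comp_hom_le_iff {X : E} (x : X ⟶ Q₁.carrier) (t : X ⟶ Q₂.carrier) :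
    Q₂.Le (x ≫ h.hom) t ↔ Q₁.Le x (t ≫ h.rightAdjoint) := by
  rw [rightAdjoint, ← Category.assoc]
  constructor
  · intro hx
    have le_sup_of_mem := (Q₁.sup_le_iff (t ≫ h.sublevel) _).1 (Le.refl _) (𝟙 X) x
    simp only [Category.id_comp] at le_sup_of_mem
    exact le_sup_of_mem ((h.mem_comp_sublevel t x).2 hx)
  · intro hx
    have hom_sup_le : Q₂.Le (((t ≫ h.sublevel) ≫ Q₁.sup) ≫ h.hom) t :=
      (h.sup_hom_le_iff _ t).2 fun f s hs =>
        (h.mem_comp_sublevel (f ≫ t) s).1 (by rwa [Category.assoc])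
    exact (h.mono hx).trans hom_sup_le

lemma iSup_comp_hom {B X : E} (f : B ⊗ X ⟶ Q₁.carrier) :
    Q₁.iSup f ≫ h.hom = Q₂.iSup (f ≫ h.hom) := by
  refine eq_of_le_iff fun t => ?_
  have iSup_le₁ := iSup_le_iff f (𝟙 X) (t ≫ h.rightAdjoint)
  have iSup_le₂ := iSup_le_iff (f ≫ h.hom) (𝟙 X) t
  rw [Category.id_comp] at iSup_le₁ iSup_le₂
  rw [comp_hom_le_iff, iSup_le₁, iSup_le₂]
  simp only [← Category.assoc, comp_hom_le_iff]

lemma guard_comp_hom {X : E} (φ : X ⟶ Om E) : Q₁.guard φ ≫ h.hom = Q₂.guard φ := by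
  refine eq_of_le_iff fun t => ?_
  have guard_le₁ := guard_le_iff φ (𝟙 X) (t ≫ h.rightAdjoint)
  have guard_le₂ := guard_le_iff (Q := Q₂) φ (𝟙 X) t
  rw [Category.id_comp] at guard_le₁ guard_le₂
  rw [comp_hom_le_iff, guard_le₁, guard_le₂]
  simp only [← Category.assoc, ← comp_hom_le_iff, MonObj.one_comp]

lemma graph_comp_hom {A B : E} (f : A ⟶ B) : Q₁.graph f ≫ h.hom = Q₂.graph f :=
  h.guard_comp_hom _

lemma relId_comp_hom (A : E) : Q₁.relId A ≫ h.hom = Q₂.relId A :=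
  h.guard_comp_hom _

lemma relComp_comp_hom {A B C : E} (R : A ⊗ B ⟶ Q₁.carrier) (S : B ⊗ C ⟶ Q₁.carrier) :
    relComp R S ≫ h.hom = relComp (R ≫ h.hom) (S ≫ h.hom) := by
  simp only [relComp, iSup_comp_hom, MonObj.mul_comp, Category.assoc]

end CommQuantale.Hom

end QuantaleMorphisms

section ChangeOfBase

variable {E : Type u} [Category.{v} E] [CartesianMonoidalCategory E] [BraidedCategory E]
  [HasFiniteLimits E] [MonoidalClosed E] [HasSubobjectClassifier E] {V : Variety.{w}}
  {Q Q₁ Q₂ Q₃ : CommQuantale E}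

namespace AlgRel

variable {A A' B B' C : Algebra V E}

/-- The algebraic relation `h ∘ R`, for `h` a morphism of quantales. -/
noncomputable def map (h : Q₁ ⟶ Q₂) (R : AlgRel Q₁ A B) : AlgRel Q₂ A B where
  rel := R.rel ≫ h.hom
  algebraic σ X a b := by
    simpa only [CommQuantale.Hom.prod_comp_hom, Category.assoc] using
      CommQuantale.Hom.mono h (R.algebraic σ a b)

lemma map_relId (h : Q₁ ⟶ Q₂) (A : Algebra V E) :
    (AlgRel.id Q₁ A).map h = AlgRel.id Q₂ A :=
  AlgRel.ext (h.relId_comp_hom A.carrier)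

lemma map_relComp (h : Q₁ ⟶ Q₂) (R : AlgRel Q₁ A B) (S : AlgRel Q₁ B C) :
    (R.comp S).map h = (R.map h).comp (S.map h) :=
  AlgRel.ext (h.relComp_comp_hom R.rel S.rel)

lemma map_relTensor (h : Q₁ ⟶ Q₂) (R : AlgRel Q₁ A B) (R' : AlgRel Q₁ A' B') :
    (R.tensor R').map h = (R.map h).tensor (R'.map h) :=
  AlgRel.ext (h.relTensor_comp_hom R.rel R'.rel)

lemma map_graph (h : Q₁ ⟶ Q₂) {f : A.carrier ⟶ B.carrier} (hf : Algebra.IsHom A B f) :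
    (AlgRel.graph Q₁ f hf).map h = AlgRel.graph Q₂ f hf :=
  AlgRel.ext (h.graph_comp_hom f)

lemma map_mono (h : Q₁ ⟶ Q₂) {R R' : AlgRel Q₁ A B} (hR : R ≤ R') : R.map h ≤ R'.map h :=
  AlgRel.le_iff.2 (CommQuantale.Hom.mono h (AlgRel.le_iff.1 hR))

lemma map_id (R : AlgRel Q A B) : R.map (𝟙 Q) = R :=
  AlgRel.ext (Category.comp_id R.rel)

lemma map_map (h : Q₁ ⟶ Q₂) (k : Q₂ ⟶ Q₃) (R : AlgRel Q₁ A B) :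
    (R.map h).map k = R.map (h ≫ k) :=
  AlgRel.ext (Category.assoc R.rel h.hom k.hom)

end AlgRel

namespace RelCat

/-- The identity-on-objects functor `h^* : Rel(Q₁) ⥤ Rel(Q₂)` of change of base along a morphism
of quantales `h`. -/
noncomputable def changeBase (V : Variety.{w}) (h : Q₁ ⟶ Q₂) : RelCat V Q₁ ⥤ RelCat V Q₂ where
  obj A := ⟨A.alg⟩
  map R := AlgRel.map h R
  map_id A := AlgRel.map_relId h A.alg
  map_comp R S := AlgRel.map_relComp h R S

variable (V)

lemma isStrictSymmetricMonoidal_changeBase (h : Q₁ ⟶ Q₂) :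
    IsStrictSymmetricMonoidal (changeBase V h) :=
  isStrictSymmetricMonoidal_of_heq (changeBase V h) rfl (fun _ _ => rfl)
    (map_whiskerLeft := fun A _ _ R => heq_of_eq <|
      (AlgRel.map_relTensor h (AlgRel.id Q₁ A.alg) R).trans <|
        congrArg (AlgRel.tensor · (AlgRel.map h R)) (AlgRel.map_relId h A.alg))
    (map_whiskerRight := fun R A => heq_of_eq <|
      (AlgRel.map_relTensor h R (AlgRel.id Q₁ A.alg)).trans <|
        congrArg (AlgRel.tensor (AlgRel.map h R)) (AlgRel.map_relId h A.alg))
    (map_associator := fun A B C => heq_of_eq <|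
      AlgRel.map_graph h (Algebra.isHom_associator_hom A.alg B.alg C.alg))
    (map_leftUnitor := fun A => heq_of_eq <|
      AlgRel.map_graph h (Algebra.isHom_leftUnitor_hom A.alg))
    (map_rightUnitor := fun A => heq_of_eq <|
      AlgRel.map_graph h (Algebra.isHom_rightUnitor_hom A.alg))
    (map_braiding := fun A B => heq_of_eq <|
      AlgRel.map_graph h (Algebra.isHom_braiding_hom A.alg B.alg))

lemma isPosFunctor_changeBase (h : Q₁ ⟶ Q₂) : IsPosFunctor (changeBase V h) :=
  fun _ _ hR => AlgRel.map_mono h hR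

lemma changeBase_id (Q : CommQuantale E) : changeBase V (𝟙 Q) = 𝟭 (RelCat V Q) :=
  Functor.hext (fun _ => rfl) fun _ _ R => heq_of_eq (AlgRel.map_id R)

lemma changeBase_comp (h : Q₁ ⟶ Q₂) (k : Q₂ ⟶ Q₃) :
    changeBase V (h ≫ k) = changeBase V h ⋙ changeBase V k :=
  Functor.hext (fun _ => rfl) fun _ _ R => heq_of_eq (AlgRel.map_map h k R).symm

end RelCat

end ChangeOfBase

end QRel

theorem mainTheorem5 {E : Type u} [Category.{v} E] [CartesianMonoidalCategory E]
    [BraidedCategory E] [HasFiniteLimits E] [MonoidalClosed E] [HasSubobjectClassifier E]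
    (V : QRel.Variety.{w}) :
    ∃ star : ∀ {Q₁ Q₂ : QRel.CommQuantale E}, (Q₁ ⟶ Q₂) →
        (QRel.RelCat V Q₁ ⥤ QRel.RelCat V Q₂),
      (∀ {Q₁ Q₂ : QRel.CommQuantale E} (h : Q₁ ⟶ Q₂),
        (∀ A : QRel.RelCat V Q₁, ((star h).obj A).alg = A.alg) ∧
        (∀ {A B : QRel.RelCat V Q₁} (R : A ⟶ B), HEq ((star h).map R).rel (R.rel ≫ h.hom)) ∧
        QRel.IsStrictSymmetricMonoidal (star h) ∧
        QRel.IsPosFunctor (star h)) ∧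
      (∀ Q : QRel.CommQuantale E, star (𝟙 Q) = 𝟭 (QRel.RelCat V Q)) ∧
      (∀ {Q₁ Q₂ Q₃ : QRel.CommQuantale E} (h : Q₁ ⟶ Q₂) (k : Q₂ ⟶ Q₃),
        star (h ≫ k) = star h ⋙ star k) :=
  ⟨fun h => QRel.RelCat.changeBase V h,
    fun h => ⟨fun _ => rfl, fun _ => HEq.rfl,
      QRel.RelCat.isStrictSymmetricMonoidal_changeBase V h,
      QRel.RelCat.isPosFunctor_changeBase V h⟩,
    QRel.RelCat.changeBase_id V, QRel.RelCat.changeBase_comp V⟩
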